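/- Fix a relational vocabulary with countably infinitely many relation symbols of each finite arity, and a countably infinite set of elements. A structure is a (finite or infinite) set of facts $R(a_1,\dots,a_k)$ over these elements; a database instance is a finite structure. A conjunctive query (CQ) is a finite conjunction of atoms $R(x_1,\dots,x_k)$ over variables, all of them existentially quantified; a union of conjunctive queries (UCQ) is a finite disjunction of CQs. Let $\mathcal T$ be a finite set of rules, each of which is either - a plain datalog rule $\Psi(\bar x)\Rightarrow R(\bar y)$, where $\Psi$ is a conjunction of atoms and every variable of $\bar y$ occurs in $\Psi$; or - an existential TGD of the form $\Psi(\bar x,y)\Rightarrow\exists\bar z\;\Phi(y,\bar z)$, where $\Psi$ and $\Phi$ are conjunctions of atoms, so that at most one variable, $y$, occurs both in the body and in the head. (All variables of the body are universally quantified.) For a database instance $D$ and a CQ $\Phi$ write $\mathcal T,D\models\Phi$ if $\Phi$ is true in every structure, finite or infinite, that contains $D$ and satisfies all the rules of $\mathcal T$. Call $\mathcal T$ - BDD if for every CQ $\Phi$ there is a UCQ $\Phi'$ such that for every database instance $D$: $\mathcal T,D\models\Phi$ if and only if $D\models\Phi'$; - FC (finitely controllable) if for every database instance $D$ and every CQ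 $\Phi$ with $\mathcal T,D\not\models\Phi$ there is a finite structure $M\supseteq D$ which satisfies all the rules of $\mathcal T$ and in which $\Phi$ is false. If $\mathcal T$ is BDD, then $\mathcal T$ is FC. -/

import Mathlib

namespace Tgd

/-- Relation symbols: a fixed vocabulary with countably many symbols of every finite arity.
Theories, instances and queries each use only finitely many of them. -/
structure RelSym where
  name : ℕ
  arity : ℕ

/-- An atom `R(t₁, …, tₖ)` whose arguments are taken from `α`. -/
structure Atom (α : Type) where
  sym : RelSym
  args : Fin sym.arity → α

/-- Apply a map to every argument of an atom. -/
def Atom.map {α β : Type} (f : α → β) (a : Atom α) : Atom β :=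
  ⟨a.sym, f ∘ a.args⟩

/-- Variables. -/
abbrev Var : Type := ℕ

/-- The countably infinite set of possible elements of databases (and of models). -/
abbrev Elem : Type := ℕ

/-- A fact is an atom over the elements. -/
abbrev Fact : Type := Atom Elem

/-- A Boolean conjunctive query: a finite conjunction of atoms over variables, all variables being
existentially quantified. -/
abbrev CQ : Type := List (Atom Var)

/-- A union of conjunctive queries: a finite disjunction of conjunctive queries. -/
abbrev UCQ : Type := List CQ

/-- The variables occurring in a conjunction of atoms. -/
def vars (Φ : CQ) : Set Var :=
  {v | ∃ a ∈ Φ, v ∈ Set.range a.args}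

/-- Under the assignment `σ` every atom of the conjunction `Φ` is a fact of the structure `M`. -/
def Sat (M : Set Fact) (σ : Var → Elem) (Φ : CQ) : Prop :=
  ∀ a ∈ Φ, a.map σ ∈ M

/-- The structure `M` satisfies the Boolean conjunctive query `Φ`. -/
def HoldsCQ (M : Set Fact) (Φ : CQ) : Prop :=
  ∃ σ : Var → Elem, Sat M σ Φ

/-- The structure `M` satisfies the union of conjunctive queries `Φ`. -/
def HoldsUCQ (M : Set Fact) (Φ : UCQ) : Prop :=
  ∃ φ ∈ Φ, HoldsCQ M φ

/-- A rule `body ⇒ ∃ z̄, head`: the variables of the body are universally quantified, and `z̄` lists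
the variables of the head that do not occur in the body. -/
structure Rule where
  body : CQ
  head : CQ

/-- The structure `M` satisfies the rule `r`. -/
def Rule.Holds (M : Set Fact) (r : Rule) : Prop :=
  ∀ σ : Var → Elem, Sat M σ r.body →
    ∃ τ : Var → Elem, (∀ v ∈ vars r.body, τ v = σ v) ∧ Sat M τ r.head

/-- A plain datalog rule: the head is one atom, all of whose variables occur in the body. -/
def Rule.IsDatalog (r : Rule) : Prop :=
  (∃ a, r.head = [a]) ∧ vars r.head ⊆ vars r.body

/-- A rule of the form `Ψ(x̄, y) ⇒ ∃ z̄, Φ(y, z̄)`, with `Φ` a conjunction of atoms: the body and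
the head share no variable other than `y`. -/
def Rule.IsSingleFrontier (r : Rule) : Prop :=
  ∃ y : Var, vars r.body ∩ vars r.head ⊆ {y}

/-- The structure `M` is a model of the theory `T`. -/
def Models (M : Set Fact) (T : Set Rule) : Prop :=
  ∀ r ∈ T, r.Holds M

/-- `T, D ⊨ Φ`: the query is true in every (finite or infinite) structure that contains `D` and
satisfies `T`. -/
def Entails (T : Set Rule) (D : Finset Fact) (Φ : CQ) : Prop :=
  ∀ M : Set Fact, (D : Set Fact) ⊆ M → Models M T → HoldsCQ M Φ

/-- `T` is BDD: it admits positive first-order query rewriting. -/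
def BDD (T : Set Rule) : Prop :=
  ∀ Φ : CQ, ∃ Φ' : UCQ, ∀ D : Finset Fact, Entails T D Φ ↔ HoldsUCQ (D : Set Fact) Φ'

/-- `T` is FC (finitely controllable): a query that is not entailed is refuted by a finite
model. -/
def FC (T : Set Rule) : Prop :=
  ∀ (D : Finset Fact) (Φ : CQ), ¬ Entails T D Φ →
    ∃ M : Finset Fact, D ⊆ M ∧ Models (M : Set Fact) T ∧ ¬ HoldsCQ (M : Set Fact) Φ

end Tgd

/-! The skolemized chase of `D` is a universal model. Existential rules have a single frontier
variable, so Skolem terms form a forest, and `D` with the facts created by existential rules forms a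
tree-like skeleton. Colour each node by the existential rules that fire there, its identity if it is
a root, its position among its siblings, and its depth modulo a large number; then identify nodes
that look alike up to a fixed radius. The quotient is finite (`finite_range_rep`), and it creates no
new small queries: a small configuration in it can be unfolded into the forest
(`Separating.exists_lift`, `Skolem.sat_skeleton_of_sat_quotient`).

BDD turns this into a statement about entailment. The rewritings of the finitely many relevant
queries have bounded size, so whatever `T` forces over the quotient it also forces over the skeleton
(`Skolem.holdsCQ_of_quotient`).

The finite model is the `saturation` of the quotient: all facts over its elements that `T` forces.
No new elements are needed. If the body of an existential rule holds there, the entailment transfers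
to the chase, with the frontier element pinned by a fresh unary mark; so the rule fires at that
element, and the images of its Skolem witnesses are already in the quotient. If `Φ` held in the
saturation, it would transfer to the chase and then, by `Skolem.exists_hom_of_models`, to every
model containing `D`. -/

namespace Tgd

/-! ### A forest on the natural numbers

The numbers `0, …, b` are roots, and every number has the `k + 1` children `child b k n i`. -/

/-- The parent of a node; a root is its own parent. -/
def parent (b k n : ℕ) : ℕ := if n ≤ b then n else (n - (b + 1)) / (k + 1)

/-- The `i`-th child of a node. -/
def child (b k n : ℕ) (i : Fin (k + 1)) : ℕ := b + 1 + (n * (k + 1) + i)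

/-- The position of a node among the children of its parent. -/
def letter (b k n : ℕ) : Fin (k + 1) := ⟨(n - (b + 1)) % (k + 1), Nat.mod_lt _ k.succ_pos⟩

theorem lt_child (b k n : ℕ) (i : Fin (k + 1)) : b < child b k n i := by
  unfold child; omega

theorem parent_of_le {b n : ℕ} (k : ℕ) (h : n ≤ b) : parent b k n = n := if_pos h

theorem parent_child (b k n : ℕ) (i : Fin (k + 1)) : parent b k (child b k n i) = n := by
  have h := lt_child b k n i
  rw [parent, if_neg (by omega), child, Nat.add_sub_cancel_left, Nat.add_comm,
    Nat.add_mul_div_right _ _ k.succ_pos, Nat.div_eq_of_lt i.2, Nat.zero_add]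

theorem letter_child (b k n : ℕ) (i : Fin (k + 1)) : letter b k (child b k n i) = i := by
  apply Fin.ext
  simp only [letter, child, Nat.add_sub_cancel_left]
  rw [Nat.add_comm, Nat.add_mul_mod_self_right, Nat.mod_eq_of_lt i.2]

theorem child_parent {b k n : ℕ} (h : b < n) : child b k (parent b k n) (letter b k n) = n := by
  rw [parent, if_neg (by omega), child, letter]
  have := Nat.div_add_mod (n - (b + 1)) (k + 1)
  rw [mul_comm] at this
  simp only [this]
  omega

theorem parent_lt {b n : ℕ} (k : ℕ) (h : b < n) : parent b k n < n := by
  rw [parent, if_neg (by omega)]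
  have := Nat.div_le_self (n - (b + 1)) (k + 1)
  omega

/-- The distance of a node from its root. -/
def depth (b k n : ℕ) : ℕ :=
  if h : b < n then depth b k (parent b k n) + 1 else 0
termination_by n
decreasing_by exact parent_lt k h

theorem depth_of_lt {b n : ℕ} (k : ℕ) (h : b < n) :
    depth b k n = depth b k (parent b k n) + 1 := by
  rw [depth, dif_pos h]

theorem depth_of_le {b n : ℕ} (k : ℕ) (h : n ≤ b) : depth b k n = 0 := by
  rw [depth, dif_neg (by omega)]

theorem depth_iterate_parent {b k : ℕ} (j n : ℕ) (h : j ≤ depth b k n) :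
    depth b k ((parent b k)^[j] n) + j = depth b k n := by
  induction j generalizing n with
  | zero => rfl
  | succ j ih =>
    have hn : b < n := by
      by_contra hn
      rw [depth_of_le k (by omega)] at h
      omega
    have hd := depth_of_lt k hn
    have := ih (parent b k n) (by omega)
    rw [Function.iterate_succ_apply]
    omega

/-- The moves in the forest: stay (`none`), go to the parent (`some none`), or go to a child. -/
abbrev Move (k : ℕ) : Type := Option (Option (Fin (k + 1)))

/-- The effect of a move on a node. -/
def act (b k : ℕ) : Move k → ℕ → ℕ
  | none, n => n
  | some none, n => parent b k n
  | some (some i), n => child b k n i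

/-- `m` and `n` have a common ancestor that is at total distance at most `d` from them. -/
def Near (b k d m n : ℕ) : Prop :=
  ∃ i j, i ≤ depth b k m ∧ j ≤ depth b k n ∧ i + j ≤ d ∧
    (parent b k)^[i] m = (parent b k)^[j] n

theorem Near.refl (b k n : ℕ) : Near b k 0 n n :=
  ⟨0, 0, Nat.zero_le _, Nat.zero_le _, le_rfl, rfl⟩

theorem Near.symm {b k d m n : ℕ} (h : Near b k d m n) : Near b k d n m := by
  obtain ⟨i, j, hi, hj, hd, e⟩ := h
  exact ⟨j, i, hj, hi, by omega, e.symm⟩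

theorem Near.act {b k d m n : ℕ} (h : Near b k d m n) (o : Move k) :
    Near b k (d + 1) m (act b k o n) := by
  obtain ⟨i, j, hi, hj, hd, e⟩ := h
  rcases o with _ | _ | c
  · exact ⟨i, j, hi, hj, by omega, e⟩
  · by_cases hn : b < n
    · have hdn := depth_of_lt k hn
      rcases j with _ | j
      -- Here `n` is itself the common ancestor. It is not a root, so `m` can climb one step
      -- further.
      · have := depth_iterate_parent i m hi
        rw [e] at this
        simp only [Function.iterate_zero, id_eq] at this e
        exact ⟨i + 1, 0, by omega, Nat.zero_le _, by omega, by
          rw [Function.iterate_succ_apply', e]; rfl⟩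
      · exact ⟨i, j, hi, by simp only [Tgd.act]; omega, by omega, e⟩
    · simp only [Tgd.act, parent_of_le k (not_lt.mp hn)]
      exact ⟨i, j, hi, hj, by omega, e⟩
  · refine ⟨i, j + 1, hi, ?_, by omega, ?_⟩
    · simp only [Tgd.act]
      rw [depth_of_lt k (lt_child b k n c), parent_child]
      omega
    · simp only [Tgd.act]
      rw [Function.iterate_succ_apply, parent_child, e]

theorem Near.foldr_act {b k d m n : ℕ} (h : Near b k d m n) (l : List (Move k)) :
    Near b k (d + l.length) m (l.foldr (Tgd.act b k) n) := by
  induction l with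
  | nil => exact h
  | cons o l ih => exact ih.act o

/-! ### Bounded bisimulation of coloured forests and lifting of finite configurations -/

section Bisimulation

variable {C : Type} (b k : ℕ) (col : ℕ → C)

/-- `m` and `n` have the same colours at the ends of all sequences of at most `N` moves. -/
def Sim (N m n : ℕ) : Prop :=
  ∀ l : List (Move k), l.length ≤ N → col (l.foldr (act b k) m) = col (l.foldr (act b k) n)

variable {b k col}

theorem Sim.refl (N n : ℕ) : Sim b k col N n n := fun _ _ => rfl

theorem Sim.symm {N m n : ℕ} (h : Sim b k col N m n) : Sim b k col N n m :=
  fun l hl => (h l hl).symm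

theorem Sim.trans {N m n p : ℕ} (h : Sim b k col N m n) (h' : Sim b k col N n p) :
    Sim b k col N m p :=
  fun l hl => (h l hl).trans (h' l hl)

theorem Sim.mono {N N' m n : ℕ} (h : Sim b k col N m n) (hN : N' ≤ N) : Sim b k col N' m n :=
  fun l hl => h l (hl.trans hN)

theorem Sim.col_eq {N m n : ℕ} (h : Sim b k col N m n) : col m = col n :=
  h [] (Nat.zero_le _)

theorem Sim.act {N m n : ℕ} (h : Sim b k col (N + 1) m n) (o : Move k) :
    Sim b k col N (act b k o m) (act b k o n) := by
  intro l hl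
  have := h (l ++ [o]) (by simpa using hl)
  simpa using this

variable (b k col) in
/-- The least node similar to a given one. -/
noncomputable def rep (N n : ℕ) : ℕ := sInf {m | Sim b k col N m n}

theorem sim_rep (N n : ℕ) : Sim b k col N (rep b k col N n) n :=
  Nat.sInf_mem (s := {m | Sim b k col N m n}) ⟨n, Sim.refl N n⟩

theorem rep_eq_of_sim {N m n : ℕ} (h : Sim b k col N m n) :
    rep b k col N m = rep b k col N n := by
  unfold rep
  congr 1
  ext p
  exact ⟨fun hp => hp.trans h, fun hp => hp.trans h.symm⟩

/-- A class is determined by the colours at the ends of finitely many move sequences. -/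
theorem finite_range_rep [Finite C] (N : ℕ) : (Set.range (rep b k col N)).Finite := by
  let W := {l : List (Move k) // l.length ≤ N}
  have : Finite W := (List.finite_length_le (Move k) N).to_subtype
  let F : ℕ → W → C := fun n l => col (l.1.foldr (act b k) n)
  have hF : ∀ m n, F m = F n → rep b k col N m = rep b k col N n := fun m n h =>
    rep_eq_of_sim fun l hl => congrFun h ⟨l, hl⟩
  have : Set.range (rep b k col N) ⊆
      Set.range fun c : Set.range F => rep b k col N c.2.choose := by
    rintro _ ⟨n, rfl⟩
    refine ⟨⟨F n, n, rfl⟩, hF _ _ ?_⟩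
    exact (⟨n, rfl⟩ : ∃ y, F y = F n).choose_spec
  exact (Set.finite_range _).subset this

/-- The colouring determines roots, positions, and depths modulo `Q`. -/
structure Separating (b k : ℕ) (col : ℕ → C) (Q : ℕ) : Prop where
  root : ∀ m n, col m = col n → m ≤ b → m = n
  letter : ∀ m n, col m = col n → letter b k m = letter b k n
  depth : ∀ m n, col m = col n → depth b k m ≡ depth b k n [MOD Q]

theorem Separating.eq_of_iterate_parent_eq {Q : ℕ} (hcol : Separating b k col Q) {N i m n : ℕ}
    (hi : i ≤ N) (h : Sim b k col N m n) (e : (parent b k)^[i] m = (parent b k)^[i] n) :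
    m = n := by
  induction i generalizing m n N with
  | zero => exact e
  | succ i ih =>
    obtain ⟨N, rfl⟩ : ∃ N', N = N' + 1 := ⟨N - 1, by omega⟩
    by_cases hm : m ≤ b
    · exact hcol.root m n h.col_eq hm
    by_cases hn : n ≤ b
    · exact (hcol.root n m h.col_eq.symm hn).symm
    have hp : parent b k m = parent b k n := ih (Nat.le_of_succ_le_succ hi) (h.act (some none)) e
    rw [← child_parent (k := k) (not_le.mp hm), ← child_parent (k := k) (not_le.mp hn), hp,
      hcol.letter m n h.col_eq]

/-- Depths congruent modulo `Q > d` force both nodes to lie equally far below the common ancestor;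
equal positions on the way down then make them coincide. -/
theorem Separating.eq_of_near {Q : ℕ} (hcol : Separating b k col Q) {d m n : ℕ} (hd : d < Q)
    (h : Sim b k col d m n) (hn : Near b k d m n) : m = n := by
  obtain ⟨i, j, hi, hj, hij, e⟩ := hn
  have h1 := depth_iterate_parent i m hi
  have h2 := depth_iterate_parent j n hj
  rw [e] at h1
  have h3 := hcol.depth m n h.col_eq
  rw [← h1, ← h2] at h3
  have h4 : i ≡ j [MOD Q] := Nat.ModEq.add_left_cancel' _ h3
  have h5 : i = j := Nat.ModEq.eq_of_lt_of_lt h4 (by omega) (by omega)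
  subst h5
  exact hcol.eq_of_iterate_parent_eq (N := d) (by omega) h e

theorem Separating.foldr_eq {Q : ℕ} (hcol : Separating b k col Q) {L N : ℕ} (hN : 2 * L ≤ N)
    (hQ : 2 * L < Q) {l l' : List (Move k)} (hl : l.length ≤ L) (hl' : l'.length ≤ L) (n : ℕ)
    (h : Sim b k col N (l.foldr (act b k) n) (l'.foldr (act b k) n)) :
    l.foldr (act b k) n = l'.foldr (act b k) n := by
  have := (((Near.refl b k n).foldr_act l).symm.foldr_act l')
  exact hcol.eq_of_near (by omega) (h.mono (by omega)) this

/-- Replays approximate moves along a walk as genuine moves in the forest; each edge costs one unit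
of similarity. -/
theorem exists_foldr_sim {W : Type} {h : W → ℕ} {N : ℕ} {G : SimpleGraph W}
    (hG : ∀ s t, G.Adj s t → ∃ o, Sim b k col N (h t) (act b k o (h s)))
    {u w : W} (p : G.Walk u w) :
    ∃ l : List (Move k), l.length = p.length ∧ ∀ m x, m + p.length ≤ N →
      Sim b k col (m + p.length) x (h u) → Sim b k col m (l.foldr (act b k) x) (h w) := by
  induction p with
  | nil => exact ⟨[], rfl, fun m x _ hx => hx⟩
  | cons hadj p ih =>
    obtain ⟨l, hl, H⟩ := ih
    obtain ⟨o, ho⟩ := hG _ _ hadj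
    refine ⟨l ++ [o], by simp [hl], fun m x hm hx => ?_⟩
    rw [SimpleGraph.Walk.length_cons] at hm hx
    rw [List.foldr_append]
    refine H m _ (by omega) ?_
    exact (Sim.act (by rwa [Nat.add_assoc]) o).trans (ho.symm.mono (by omega))

/-- A finite configuration of nodes whose moves are correct up to similarity can be replaced by one
with the same colours in which they are correct. -/
theorem Separating.exists_lift {Q : ℕ} (hcol : Separating b k col Q) {L N : ℕ}
    (hN : 4 * L + 4 ≤ N) (hQ : 2 * L + 2 < Q) {W : Type} [Finite W] (hW : Nat.card W ≤ L)
    (h : W → ℕ) (s₀ : W) :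
    ∃ h' : W → ℕ, h' s₀ = h s₀ ∧ (∀ w, col (h' w) = col (h w)) ∧
      ∀ s t (g : Option (Fin (k + 1))), Sim b k col N (h t) (act b k (g.map some) (h s)) →
        h' t = act b k (g.map some) (h' s) := by
  classical
  have := Fintype.ofFinite W
  let G : SimpleGraph W := SimpleGraph.fromRel fun s t =>
    ∃ g : Option (Fin (k + 1)), Sim b k col N (h t) (act b k (g.map some) (h s))
  -- Traversing an edge backwards means undoing a child move by a parent move, which loses one
  -- level.
  have hG : ∀ s t, G.Adj s t → ∃ o, Sim b k col (N - 1) (h t) (act b k o (h s)) := by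
    rintro s t ⟨-, ⟨g, hg⟩ | ⟨g, hg⟩⟩
    · exact ⟨_, hg.mono (by omega)⟩
    · rcases g with _ | i
      · exact ⟨none, (Sim.symm hg).mono (by omega)⟩
      · refine ⟨some none, ?_⟩
        have := Sim.act (N := N - 1) (hg.mono (by omega)) (some none)
        simp only [Option.map_some, Tgd.act, parent_child] at this
        exact this.symm
  -- Each component is rebuilt from one base node; `s₀` is the base of its own component, so that
  -- its value is preserved.
  let base : G.ConnectedComponent → W := fun c =>
    if c = G.connectedComponentMk s₀ then s₀ else c.out
  have hbase : ∀ w, G.Reachable (base (G.connectedComponentMk w)) w := by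
    intro w
    apply SimpleGraph.ConnectedComponent.exact
    simp only [base]
    split_ifs with hw
    · exact hw.symm
    · exact Quot.out_eq _
  have key : ∀ w, ∃ l : List (Move k), l.length ≤ L ∧
      Sim b k col (N - 1 - L) (l.foldr (act b k) (h (base (G.connectedComponentMk w)))) (h w) := by
    intro w
    obtain ⟨p, hp⟩ := (hbase w).exists_isPath
    have hlen := hp.length_lt
    rw [← Nat.card_eq_fintype_card] at hlen
    obtain ⟨l, hl, H⟩ := exists_foldr_sim hG p
    exact ⟨l, by omega, H _ _ (by omega) (Sim.refl _ _)⟩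
  choose l hl hsim using key
  refine ⟨fun w => (l w).foldr (act b k) (h (base (G.connectedComponentMk w))), ?_,
    fun w => (hsim w).col_eq, ?_⟩
  · have hb : base (G.connectedComponentMk s₀) = s₀ := if_pos rfl
    have := hsim s₀
    simp only [hb] at this ⊢
    exact hcol.foldr_eq (L := L) (l' := []) (by omega) (by omega) (hl s₀) (Nat.zero_le _) _ this
  · intro s t g hg
    have hc : G.connectedComponentMk s = G.connectedComponentMk t := by
      by_cases hst : s = t
      · rw [hst]
      · exact SimpleGraph.ConnectedComponent.sound
          (SimpleGraph.Adj.reachable ⟨hst, Or.inl ⟨g, hg⟩⟩)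
    have h1 := hsim s
    have h2 := hsim t
    simp only [hc] at h1 ⊢
    -- Both routes to `t` start at the same base, have at most `L + 1` moves and end at similar
    -- nodes, so they end at the same node.
    refine hcol.foldr_eq (L := L + 1) (N := N - 2 - L) (l' := g.map some :: l s) (by omega)
      (by omega) ((hl t).trans (Nat.le_succ _)) (by simpa using hl s) _ ?_
    refine (h2.mono (by omega)).trans ((hg.mono (by omega)).trans ?_)
    exact (Sim.act (h1.mono (by omega)) _).symm

end Bisimulation

end Tgd

namespace Tgd

/-! ### Atoms and conjunctions -/

theorem mem_vars {Φ : CQ} {a : Atom Var} (ha : a ∈ Φ) (i : Fin a.sym.arity) :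
    a.args i ∈ vars Φ :=
  ⟨a, ha, i, rfl⟩

theorem finite_vars (Φ : CQ) : (vars Φ).Finite := by
  have : vars Φ = ⋃ a ∈ {a | a ∈ Φ}, Set.range a.args := by
    ext v
    simp [vars]
  rw [this]
  exact Set.Finite.biUnion (List.finite_toSet Φ) fun a _ => Set.finite_range _

theorem Atom.map_map {α β γ : Type} (f : α → β) (g : β → γ) (a : Atom α) :
    (a.map f).map g = a.map (g ∘ f) := rfl

theorem Atom.map_congr {α β : Type} {f g : α → β} {a : Atom α}
    (h : ∀ i, f (a.args i) = g (a.args i)) : a.map f = a.map g := by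
  have : f ∘ a.args = g ∘ a.args := funext h
  simp only [Atom.map, this]

theorem Atom.map_eq_self {α : Type} {f : α → α} {a : Atom α}
    (h : ∀ i, f (a.args i) = a.args i) : a.map f = a :=
  Atom.map_congr (g := id) h

theorem Atom.exists_args_of_map_eq {α β γ : Type} {f : α → γ} {g : β → γ} {a : Atom α}
    {a' : Atom β} (h : a.map f = a'.map g) :
    ∃ x : Fin a.sym.arity → β, a' = ⟨a.sym, x⟩ ∧ ∀ i, f (a.args i) = g (x i) := by
  obtain ⟨s, x⟩ := a
  obtain ⟨s', x'⟩ := a'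
  simp only [Atom.map, Atom.mk.injEq] at h
  obtain ⟨rfl, h⟩ := h
  exact ⟨x', rfl, congrFun (eq_of_heq h)⟩

theorem Sat.congr {M : Set Fact} {σ τ : Var → Elem} {Φ : CQ} (h : Sat M σ Φ)
    (e : ∀ v ∈ vars Φ, τ v = σ v) : Sat M τ Φ := fun a ha => by
  rw [Atom.map_congr fun i => e _ (mem_vars ha i)]
  exact h a ha

theorem Sat.mono {M N : Set Fact} {σ : Var → Elem} {Φ : CQ} (h : Sat M σ Φ) (hMN : M ⊆ N) :
    Sat N σ Φ := fun a ha => hMN (h a ha)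

theorem finite_setOf_atoms {S : Set RelSym} (hS : S.Finite) {U : Set Elem} (hU : U.Finite) :
    {f : Fact | f.sym ∈ S ∧ ∀ i, f.args i ∈ U}.Finite := by
  have := hS.to_subtype
  have := hU.to_subtype
  let F : (Σ s : S, (Fin s.1.arity → U)) → Fact := fun p => ⟨p.1.1, fun i => (p.2 i).1⟩
  refine (Set.finite_range F).subset ?_
  rintro ⟨s, x⟩ ⟨hs, hx⟩
  exact ⟨⟨⟨s, hs⟩, fun i => ⟨x i, hx i⟩⟩, rfl⟩

/-- The relation symbols of a conjunction. -/
def syms (Φ : CQ) : Set RelSym := {s | ∃ a ∈ Φ, a.sym = s}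

theorem finite_syms (Φ : CQ) : (syms Φ).Finite :=
  (List.finite_toSet (Φ.map Atom.sym)).subset fun _ ⟨a, ha, e⟩ =>
    List.mem_map.2 ⟨a, ha, e⟩

/-- Facts whose symbol does not occur in a rule are irrelevant for the truth of its body. -/
theorem Sat.of_union {M X : Set Fact} {σ : Var → Elem} {Φ : CQ} (h : Sat (M ∪ X) σ Φ)
    (hX : ∀ f ∈ X, f.sym ∉ syms Φ) : Sat M σ Φ := fun a ha =>
  (h a ha).resolve_right fun hx => hX _ hx ⟨a, ha, rfl⟩

/-! ### The chase -/

/-- A presentation of the Skolem terms as nodes of the forest on `ℕ`: a frontier variable for every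
rule and a position for every head variable. -/
structure Skolem where
  b : ℕ
  k : ℕ
  front : Rule → Var
  code : Rule → Var → Fin (k + 1)

namespace Skolem

variable (s : Skolem) (P E : Set Rule) (D : Set Fact)

/-- The assignment of Skolem terms to the head variables of `r`, when `r` is applied at `n`. -/
def witness (r : Rule) (n : Elem) (v : Var) : Elem :=
  if v = s.front r then n else child s.b s.k n (s.code r v)

/-- `A` contains `D` and is closed under the plain rules `P` and the skolemized rules `E`. -/
structure Closed (A : Set Fact) : Prop where
  base : D ⊆ A
  plain : ∀ r ∈ P, ∀ σ, Sat A σ r.body → Sat A σ r.head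
  exist : ∀ r ∈ E, ∀ σ, Sat A σ r.body → Sat A (s.witness r (σ (s.front r))) r.head

/-- The skolemized chase. -/
def chase : Set Fact := {f | ∀ A, s.Closed P E D A → f ∈ A}

theorem closed_chase : s.Closed P E D (s.chase P E D) where
  base _ hf _ hA := hA.base hf
  plain r hr σ h a ha A hA := hA.plain r hr σ (h.mono fun _ hf => hf A hA) a ha
  exist r hr σ h a ha A hA := hA.exist r hr σ (h.mono fun _ hf => hf A hA) a ha

/-- The rule `r` is applied at `n` in the chase. -/
def Fires (r : Rule) (n : Elem) : Prop :=
  ∃ σ, Sat (s.chase P E D) σ r.body ∧ σ (s.front r) = n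

/-- The part of the chase that consists of `D` and of the facts created by existential rules. -/
def skeleton : Set Fact :=
  D ∪ {f | ∃ r ∈ E, ∃ n, s.Fires P E D r n ∧ ∃ a ∈ r.head, f = a.map (s.witness r n)}

theorem skeleton_subset_chase : s.skeleton P E D ⊆ s.chase P E D := by
  rintro f (hf | ⟨r, hr, n, ⟨σ, hσ, rfl⟩, a, ha, rfl⟩)
  · exact (s.closed_chase P E D).base hf
  · exact (s.closed_chase P E D).exist r hr σ hσ a ha

variable {s P E D}

/-- The frontier variables and positions are chosen correctly for the rules in `E`. -/
structure Valid (s : Skolem) (E : Set Rule) : Prop where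
  inter : ∀ r ∈ E, vars r.body ∩ vars r.head ⊆ {s.front r}
  front : ∀ r ∈ E, s.front r ∈ vars r.head → s.front r ∈ vars r.body
  decode : ∃ dec : Fin (s.k + 1) → Rule × Var, ∀ r ∈ E, ∀ v ∈ vars r.head,
    dec (s.code r v) = (r, v)

theorem Closed.models {A : Set Fact} (h : s.Closed P E D A) (hs : s.Valid E) :
    Models A (P ∪ E) := by
  classical
  rintro r (hr | hr) σ hσ
  · exact ⟨σ, fun _ _ => rfl, h.plain r hr σ hσ⟩
  · refine ⟨fun v => if v ∈ vars r.body then σ v else s.witness r (σ (s.front r)) v,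
      fun v hv => if_pos hv, (h.exist r hr σ hσ).congr fun v hv => ?_⟩
    by_cases hb : v ∈ vars r.body
    · obtain rfl : v = s.front r := hs.inter r hr ⟨hb, hv⟩
      simp [hb, witness]
    · simp [hb]

/-- Facts over symbols absent from all bodies trigger no rule; used to add a mark to the chase. -/
theorem Closed.union {A X : Set Fact} (h : s.Closed P E D A)
    (hX : ∀ r ∈ P ∪ E, ∀ f ∈ X, f.sym ∉ syms r.body) : s.Closed P E D (A ∪ X) where
  base := h.base.trans Set.subset_union_left
  plain r hr σ hσ :=
    (h.plain r hr σ (hσ.of_union (hX r (Or.inl hr)))).mono Set.subset_union_left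
  exist r hr σ hσ :=
    (h.exist r hr σ (hσ.of_union (hX r (Or.inr hr)))).mono Set.subset_union_left

/-- The chase maps homomorphically to every model that contains the database. -/
theorem exists_hom_of_models (hs : s.Valid E) (hD : ∀ f ∈ D, ∀ i, f.args i ≤ s.b)
    (hP : ∀ r ∈ P, vars r.head ⊆ vars r.body) {N : Set Fact} (hDN : D ⊆ N)
    (hN : Models N (P ∪ E)) :
    ∃ H : Elem → Elem, ∀ f ∈ s.chase P E D, f.map H ∈ N := by
  classical
  obtain ⟨dec, hdec⟩ := hs.decode
  -- The witnesses are chosen as a function of the rule and the frontier value only, as Skolem terms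
  -- are.
  have hex : ∀ (r : Rule) (n : Elem), ∃ τ : Var → Elem, r ∈ E →
      (∃ σ, Sat N σ r.body ∧ σ (s.front r) = n) →
      Sat N τ r.head ∧ (s.front r ∈ vars r.body → τ (s.front r) = n) := by
    intro r n
    by_cases h : r ∈ E ∧ ∃ σ, Sat N σ r.body ∧ σ (s.front r) = n
    · obtain ⟨hr, σ, hσ, rfl⟩ := h
      obtain ⟨τ, hτ, hτ'⟩ := hN r (Or.inr hr) σ hσ
      exact ⟨τ, fun _ _ => ⟨hτ', fun hb => hτ _ hb⟩⟩
    · exact ⟨id, fun h1 h2 => (h ⟨h1, h2⟩).elim⟩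
  choose W hW using hex
  let F : ∀ n : ℕ, (∀ m, m < n → Elem) → Elem := fun n ih =>
    if h : s.b < n then
      W (dec (letter s.b s.k n)).1 (ih (parent s.b s.k n) (parent_lt _ h))
        (dec (letter s.b s.k n)).2
    else n
  let H : Elem → Elem := fun n => Nat.strongRec F n
  have hH : ∀ n, H n = F n fun m _ => H m := fun n => by
    simp only [H]
    rw [Nat.strongRec]
  have hroot : ∀ n ≤ s.b, H n = n := fun n hn => by
    rw [hH]
    exact dif_neg (not_lt.2 hn)
  have hchild : ∀ r ∈ E, ∀ v ∈ vars r.head, ∀ n,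
      H (child s.b s.k n (s.code r v)) = W r (H n) v := fun r hr v hv n => by
    rw [hH]
    simp only [F]
    rw [dif_pos (lt_child _ _ _ _), letter_child, parent_child, hdec r hr v hv]
  -- Minimality of the chase: the preimage of `N` under `H` is closed.
  refine ⟨H, fun f hf => hf {f | f.map H ∈ N} ⟨fun f hf => ?_, fun r hr σ hσ a ha => ?_,
    fun r hr σ hσ a ha => ?_⟩⟩
  · change f.map H ∈ N
    rw [Atom.map_eq_self fun i => hroot _ (hD f hf i)]
    exact hDN hf
  · obtain ⟨τ, h1, h2⟩ := hN r (Or.inl hr) (H ∘ σ) hσ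
    change a.map (H ∘ σ) ∈ N
    rw [← Atom.map_congr fun i => h1 _ (hP r hr (mem_vars ha i))]
    exact h2 a ha
  · obtain ⟨h1, h2⟩ := hW r (H (σ (s.front r))) hr ⟨H ∘ σ, hσ, rfl⟩
    change a.map (H ∘ s.witness r (σ (s.front r))) ∈ N
    rw [Atom.map_congr (g := W r (H (σ (s.front r))))]
    · exact h1 a ha
    · intro i
      have hv := mem_vars ha i
      generalize a.args i = v at hv
      by_cases hvf : v = s.front r
      · subst hvf
        simp [witness, h2 (hs.front r hr hv)]
      · simp [witness, hvf, hchild r hr v hv]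

/-! ### The finite quotient of the skeleton -/

variable (s P E D) in
/-- The colour of a node: the rules applied there, its identity if it is a root, its position, and
its depth modulo `q + 1`. -/
noncomputable def color (q : ℕ) (n : Elem) :
    Set E × Fin (s.b + 2) × Fin (s.k + 1) × Fin (q + 1) :=
  ({r | s.Fires P E D r.1 n}, ⟨min n (s.b + 1), by omega⟩, letter s.b s.k n,
    ⟨depth s.b s.k n % (q + 1), Nat.mod_lt _ q.succ_pos⟩)

theorem separating_color (q : ℕ) : Separating s.b s.k (s.color P E D q) (q + 1) where
  root m n h hm := by
    simp only [color, Prod.mk.injEq, Fin.mk.injEq] at h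
    omega
  letter m n h := by
    simp only [color, Prod.mk.injEq] at h
    exact h.2.2.1
  depth m n h := by
    simp only [color, Prod.mk.injEq, Fin.mk.injEq] at h
    exact h.2.2.2

theorem fires_iff_of_color_eq {q : ℕ} {m n : Elem} (h : s.color P E D q m = s.color P E D q n)
    {r : Rule} (hr : r ∈ E) : s.Fires P E D r m ↔ s.Fires P E D r n := by
  simp only [color, Prod.mk.injEq] at h
  exact Set.ext_iff.1 h.1 ⟨r, hr⟩

/-- A bound on the size of the configurations that witness a conjunctive query. -/
noncomputable def size (Φ : CQ) : ℕ := Nat.card ((vars Φ ⊕ {a // a ∈ Φ}) ⊕ Unit)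

/-- A small query that holds in the quotient of the skeleton holds in the skeleton, also in the
presence of additional facts `X` about a single element `n`. -/
theorem sat_skeleton_of_sat_quotient {L q N : ℕ} (hN : 4 * L + 4 ≤ N) (hq : 2 * L + 2 ≤ q)
    (hD : ∀ f ∈ D, ∀ i, f.args i ≤ s.b) {n : Elem} {X : Set Fact}
    (hX : ∀ f ∈ X, ∀ i, f.args i = n) {Φ : CQ} (hΦ : size Φ ≤ L)
    (h : HoldsCQ (Atom.map (rep s.b s.k (s.color P E D q) N) '' (s.skeleton P E D ∪ X)) Φ) :
    HoldsCQ (s.skeleton P E D ∪ X) Φ := by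
  classical
  obtain ⟨σ, hσ⟩ := h
  set ρ := rep s.b s.k (s.color P E D q) N with hρ
  have hcol := separating_color (s := s) (P := P) (E := E) (D := D) q
  have hcases : ∀ a : {a // a ∈ Φ}, ∃ m : Elem,
      (∃ x, ⟨a.1.sym, x⟩ ∈ D ∧ ∀ i, σ (a.1.args i) = ρ (x i)) ∨
      (∃ r ∈ E, s.Fires P E D r m ∧ ∃ x : Fin a.1.sym.arity → Var, ⟨a.1.sym, x⟩ ∈ r.head ∧
        ∀ i, σ (a.1.args i) = ρ (s.witness r m (x i))) ∨
      (∃ x, ⟨a.1.sym, x⟩ ∈ X ∧ ∀ i, σ (a.1.args i) = ρ (x i)) := by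
    rintro ⟨a, ha⟩
    obtain ⟨f, (hf | ⟨r, hr, m, hm, c, hc, rfl⟩) | hf, e⟩ := hσ a ha
    · obtain ⟨x, rfl, hx⟩ := Atom.exists_args_of_map_eq e.symm
      exact ⟨0, Or.inl ⟨x, hf, hx⟩⟩
    · rw [Atom.map_map] at e
      obtain ⟨x, rfl, hx⟩ := Atom.exists_args_of_map_eq e.symm
      exact ⟨m, Or.inr (Or.inl ⟨r, hr, hm, x, hc, hx⟩)⟩
    · obtain ⟨x, rfl, hx⟩ := Atom.exists_args_of_map_eq e.symm
      exact ⟨0, Or.inr (Or.inr ⟨x, hf, hx⟩)⟩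
  choose anchor hanchor using hcases
  have := (finite_vars Φ).to_subtype
  have : Finite {a // a ∈ Φ} := (List.finite_toSet Φ).to_subtype
  -- The configuration consists of the values of the variables, for each atom the node whose rule
  -- application created it (0 if there is none), and `n`, which stays fixed.
  obtain ⟨h', hstar, hc, hmove⟩ := hcol.exists_lift hN (by omega) hΦ
    (Sum.elim (Sum.elim (fun v => σ v) anchor) fun _ => n) (Sum.inr ())
  refine ⟨fun v => if hv : v ∈ vars Φ then h' (Sum.inl (Sum.inl ⟨v, hv⟩)) else 0,
    fun a ha => ?_⟩
  have hval : ∀ y : Fin a.sym.arity → Elem,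
      (∀ i, h' (Sum.inl (Sum.inl ⟨a.args i, mem_vars ha i⟩)) = y i) →
      a.map (fun v => if hv : v ∈ vars Φ then h' (Sum.inl (Sum.inl ⟨v, hv⟩)) else 0) =
        ⟨a.sym, y⟩ := by
    intro y hy
    simp only [Atom.map, Atom.mk.injEq, heq_eq_eq, true_and]
    funext i
    simp [mem_vars ha i, hy i]
  rcases hanchor ⟨a, ha⟩ with ⟨x, hx, e⟩ | ⟨r, hr, hm, x, hx, e⟩ | ⟨x, hx, e⟩
  · rw [hval x fun i => ?_]
    · exact Or.inl (Or.inl hx)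
    · have h1 := hc (Sum.inl (Sum.inl ⟨a.args i, mem_vars ha i⟩))
      simp only [Sum.elim_inl, e i] at h1
      exact (hcol.root _ _ (h1.trans (sim_rep N (x i)).col_eq).symm (hD _ hx i)).symm
  · refine Or.inl (Or.inr ⟨r, hr, h' (Sum.inl (Sum.inr ⟨a, ha⟩)), ?_, _, hx, ?_⟩)
    · exact (fires_iff_of_color_eq (hc (Sum.inl (Sum.inr ⟨a, ha⟩))) hr).2 hm
    · refine hval _ fun i => ?_
      have h1 := hmove (Sum.inl (Sum.inr ⟨a, ha⟩)) (Sum.inl (Sum.inl ⟨a.args i, mem_vars ha i⟩))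
        (if x i = s.front r then none else some (s.code r (x i))) (by
          simp only [Sum.elim_inl, Sum.elim_inr, e i]
          refine (sim_rep N _).trans ?_
          unfold witness
          split_ifs <;> exact Sim.refl _ _)
      rw [h1]
      simp only [Function.comp_apply, witness]
      split_ifs <;> rfl
  · rw [hval x fun i => ?_]
    · exact Or.inr hx
    · have hxi : x i = n := hX _ hx i
      have h1 := hmove (Sum.inr ()) (Sum.inl (Sum.inl ⟨a.args i, mem_vars ha i⟩)) none (by
          simp only [Sum.elim_inl, Sum.elim_inr, e i, hxi]
          exact sim_rep N _)
      rw [h1, hxi]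
      exact hstar

end Skolem

end Tgd

/-! ### Choice of Skolem data, transfer of entailment from the quotient, saturation -/

namespace Tgd

namespace Skolem

variable {s : Skolem} {P E : Set Rule} {D : Set Fact}

theorem exists_valid {E : Set Rule} (hE : E.Finite) (h : ∀ r ∈ E, r.IsSingleFrontier) (b : ℕ) :
    ∃ s : Skolem, s.b = b ∧ s.Valid E := by
  classical
  have hfront : ∀ r : Rule, ∃ y : Var, r ∈ E → vars r.body ∩ vars r.head ⊆ {y} ∧
      (y ∈ vars r.head → y ∈ vars r.body) := by
    intro r
    rcases (vars r.body ∩ vars r.head).eq_empty_or_nonempty with h0 | ⟨y, hy⟩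
    -- With an empty frontier, a variable outside the head serves as a dummy frontier.
    · obtain ⟨y, hy⟩ := (finite_vars r.head).exists_notMem
      exact ⟨y, fun _ => ⟨by simp [h0], fun hy' => (hy hy').elim⟩⟩
    · refine ⟨y, fun hr => ⟨?_, fun _ => hy.1⟩⟩
      obtain ⟨z, hz⟩ := h r hr
      obtain rfl : y = z := hz hy
      exact hz
  choose front hfront using hfront
  have hG : (⋃ r ∈ E, (fun v => (r, v)) '' vars r.head).Finite :=
    hE.biUnion fun r _ => (finite_vars r.head).image _
  generalize hGdef : (⋃ r ∈ E, (fun v => (r, v)) '' vars r.head) = G at hG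
  have := hG.to_subtype
  obtain ⟨k, ⟨e⟩⟩ := Finite.exists_equiv_fin G
  refine ⟨⟨b, k, front, fun r v => if h : (r, v) ∈ G then (e ⟨(r, v), h⟩).castSucc else Fin.last k⟩,
    rfl, fun r hr => (hfront r hr).1, fun r hr => (hfront r hr).2,
    fun i => if h : i.1 < k then (e.symm ⟨i, h⟩).1 else (⟨[], []⟩, 0), fun r hr v hv => ?_⟩
  have hmem : (r, v) ∈ G := by
    rw [← hGdef]
    exact Set.mem_biUnion hr ⟨v, hv, rfl⟩
  simp [hmem]

/-- Queries with small rewritings that are entailed by the quotient of the skeleton are entailed by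
the skeleton, also in the presence of additional facts `X` about a single element. -/
theorem holdsCQ_of_quotient {T : Set Rule} {L q N : ℕ} (hN : 4 * L + 4 ≤ N)
    (hq : 2 * L + 2 ≤ q) (hD : ∀ f ∈ D, ∀ i, f.args i ≤ s.b) {n : Elem} {X : Set Fact}
    (hX : ∀ f ∈ X, ∀ i, f.args i = n) {Φ : CQ} {Φ' : UCQ}
    (hΦ : ∀ D : Finset Fact, Entails T D Φ ↔ HoldsUCQ (D : Set Fact) Φ')
    (hsize : ∀ φ ∈ Φ', size φ ≤ L)
    (hfin : (Atom.map (rep s.b s.k (s.color P E D q) N) '' (s.skeleton P E D ∪ X)).Finite)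
    (h : ∀ A, Atom.map (rep s.b s.k (s.color P E D q) N) '' (s.skeleton P E D ∪ X) ⊆ A →
      Models A T → HoldsCQ A Φ)
    {A : Set Fact} (hA : s.skeleton P E D ∪ X ⊆ A) (hAT : Models A T) : HoldsCQ A Φ := by
  classical
  obtain ⟨φ, hφ, hφ'⟩ := (hΦ hfin.toFinset).1 fun A hA => h A (by simpa using hA)
  rw [Set.Finite.coe_toFinset] at hφ'
  obtain ⟨σ, hσ⟩ := sat_skeleton_of_sat_quotient hN hq hD hX (hsize φ hφ) hφ'
  -- The skeleton may be infinite, so the rewriting is applied to the finite image of `φ` in it.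
  refine (hΦ (φ.map (Atom.map σ)).toFinset).2 ⟨φ, hφ, σ, fun a ha => ?_⟩ A ?_ hAT
  · simpa using ⟨a, ha, rfl⟩
  · intro f hf
    obtain ⟨a, ha, rfl⟩ : ∃ a ∈ φ, Atom.map σ a = f := by simpa using hf
    exact hA (hσ a ha)

end Skolem

/-- The facts over the symbols `S` and the elements `U` that hold in all models of `T` that
contain `M`. -/
def saturation (T : Set Rule) (S : Set RelSym) (U : Set Elem) (M : Set Fact) : Set Fact :=
  {f | (f.sym ∈ S ∧ ∀ i, f.args i ∈ U) ∧ ∀ A, M ⊆ A → Models A T → f ∈ A}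

theorem saturation_subset {T : Set Rule} {S : Set RelSym} {U : Set Elem} {M A : Set Fact}
    (hM : M ⊆ A) (hA : Models A T) : saturation T S U M ⊆ A :=
  fun _ hf => hf.2 A hM hA

theorem Rule.Holds.saturation {T : Set Rule} {S : Set RelSym} {U : Set Elem} {M : Set Fact}
    {r : Rule} (hr : r ∈ T) (hv : vars r.head ⊆ vars r.body) (hS : syms r.head ⊆ S) :
    r.Holds (saturation T S U M) := by
  refine fun σ hσ => ⟨σ, fun _ _ => rfl, fun a ha => ⟨⟨hS ⟨a, ha, rfl⟩, fun i => ?_⟩, ?_⟩⟩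
  · obtain ⟨c, hc, j, e⟩ := hv (mem_vars ha i)
    have : σ (c.args j) ∈ U := (hσ c hc).1.2 j
    change σ (a.args i) ∈ U
    rwa [← e]
  · intro A hM hA
    obtain ⟨τ, h1, h2⟩ := hA r hr σ (hσ.mono (saturation_subset hM hA))
    rw [← Atom.map_congr fun i => h1 _ (hv (mem_vars ha i))]
    exact h2 a ha

end Tgd

/-! ### The finite countermodel -/

open Tgd in
theorem theorem3 (T : Set Tgd.Rule) (hfin : T.Finite)
    (hT : ∀ r ∈ T, r.IsDatalog ∨ r.IsSingleFrontier)
    (hBDD : Tgd.BDD T) : Tgd.FC T := by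
  classical
  intro D Φ hnot
  obtain ⟨P, hPdef⟩ : ∃ P, P = {r ∈ T | r.IsDatalog} := ⟨_, rfl⟩
  obtain ⟨E, hEdef⟩ : ∃ E, E = {r ∈ T | r.IsSingleFrontier} := ⟨_, rfl⟩
  have hPE : P ∪ E = T := by
    ext r
    simp only [hPdef, hEdef, Set.mem_union, Set.mem_ofPred_eq]
    exact ⟨fun h => h.elim And.left And.left,
      fun h => (hT r h).imp (fun h' => ⟨h, h'⟩) fun h' => ⟨h, h'⟩⟩
  have hPv : ∀ r ∈ P, vars r.head ⊆ vars r.body := fun r hr => by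
    rw [hPdef] at hr
    exact hr.2.2
  have hET : E ⊆ T := hPE ▸ Set.subset_union_right
  have hEfin : E.Finite := hfin.subset hET
  have hargs : (⋃ f ∈ D, Set.range f.args).Finite :=
    D.finite_toSet.biUnion fun f _ => Set.finite_range _
  obtain ⟨b, hb⟩ := hargs.bddAbove
  have hDb : ∀ f ∈ (D : Set Fact), ∀ i, f.args i ≤ b := fun f hf i =>
    hb (Set.mem_biUnion (Finset.mem_coe.1 hf) ⟨i, rfl⟩)
  obtain ⟨s, rfl, hs⟩ := Skolem.exists_valid hEfin
    (fun r hr => by rw [hEdef] at hr; exact hr.2) b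
  obtain ⟨S, hSdef⟩ : ∃ S : Set RelSym,
    S = (Atom.sym '' (D : Set Fact)) ∪ ⋃ r ∈ T, (syms r.body ∪ syms r.head) := ⟨_, rfl⟩
  have hSfin : S.Finite := by
    rw [hSdef]
    exact (D.finite_toSet.image _).union
      (hfin.biUnion fun r _ => (finite_syms _).union (finite_syms _))
  have hSr : ∀ r ∈ T, syms r.body ⊆ S ∧ syms r.head ⊆ S := fun r hr => by
    rw [← Set.union_subset_iff, hSdef]
    exact (Set.subset_biUnion_of_mem (u := fun r : Rule => syms r.body ∪ syms r.head) hr).trans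
      Set.subset_union_right
  obtain ⟨p, hp⟩ : ∃ p : ℕ, (⟨p, 1⟩ : RelSym) ∉ S := by
    have : ((fun p : ℕ => (⟨p, 1⟩ : RelSym)) ⁻¹' S).Finite :=
      hSfin.preimage fun x _ y _ h => by simpa using h
    exact this.exists_notMem
  choose rw' hrw using hBDD
  let mark : ℕ → Atom ℕ := fun n => ⟨⟨p, 1⟩, fun _ => n⟩
  -- `L` bounds all the rewritings to be transferred, and is fixed before the quotient is formed.
  obtain ⟨L, hL⟩ : ∃ L, (∀ φ ∈ rw' Φ, Skolem.size φ ≤ L) ∧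
      ∀ r ∈ E, ∀ φ ∈ rw' (mark (s.front r) :: r.body), Skolem.size φ ≤ L := by
    have hF : ({φ | φ ∈ rw' Φ} ∪ ⋃ r ∈ E, {φ | φ ∈ rw' (mark (s.front r) :: r.body)}).Finite :=
      (List.finite_toSet _).union (hEfin.biUnion fun r _ => List.finite_toSet _)
    obtain ⟨L, hL⟩ := (hF.image Skolem.size).bddAbove
    exact ⟨L, fun φ hφ => hL ⟨φ, Or.inl hφ, rfl⟩,
      fun r hr φ hφ => hL ⟨φ, Or.inr (Set.mem_biUnion hr hφ), rfl⟩⟩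
  have := hEfin.to_subtype
  have hU := finite_range_rep (b := s.b) (k := s.k)
    (col := s.color P E D (2 * L + 2)) (4 * L + 4)
  have hcol := Skolem.separating_color (s := s) (P := P) (E := E) (D := D) (2 * L + 2)
  have hsim := sim_rep (b := s.b) (k := s.k) (col := s.color P E D (2 * L + 2)) (4 * L + 4)
  have hidem : ∀ n, rep s.b s.k (s.color P E D (2 * L + 2)) (4 * L + 4)
      (rep s.b s.k (s.color P E D (2 * L + 2)) (4 * L + 4) n) =
      rep s.b s.k (s.color P E D (2 * L + 2)) (4 * L + 4) n := fun n => rep_eq_of_sim (hsim n)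
  have transfer := fun n X hX Ψ hsize => Skolem.holdsCQ_of_quotient (s := s) (P := P) (E := E)
    (D := D) (T := T) (L := L) le_rfl le_rfl hDb (n := n) (X := X) hX (hrw Ψ) hsize
  generalize rep s.b s.k (s.color P E D (2 * L + 2)) (4 * L + 4) = ρ at *
  have hroot : ∀ n ≤ s.b, ρ n = n := fun n hn =>
    (hcol.root _ _ (hsim n).col_eq.symm hn).symm
  have hskelS : ∀ f ∈ s.skeleton P E D, f.sym ∈ S := by
    rintro f (hf | ⟨r, hr, n, -, a, ha, rfl⟩)
    · rw [hSdef]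
      exact Or.inl ⟨f, hf, rfl⟩
    · exact (hSr r (hET hr)).2 ⟨a, ha, rfl⟩
  have hMsub : Atom.map ρ '' s.skeleton P E D ⊆
      {f | f.sym ∈ S ∧ ∀ i, f.args i ∈ Set.range ρ} := by
    rintro _ ⟨f, hf, rfl⟩
    exact ⟨hskelS f hf, fun i => ⟨f.args i, rfl⟩⟩
  have hMfin := (finite_setOf_atoms hSfin hU).subset hMsub
  have hsatfin : (saturation T S (Set.range ρ) (Atom.map ρ '' s.skeleton P E D)).Finite :=
    (finite_setOf_atoms hSfin hU).subset fun f hf => hf.1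
  have hMsat : Atom.map ρ '' s.skeleton P E D ⊆
      saturation T S (Set.range ρ) (Atom.map ρ '' s.skeleton P E D) :=
    fun f hf => ⟨hMsub hf, fun A hA _ => hA hf⟩
  have hchase := s.closed_chase P E D
  refine ⟨hsatfin.toFinset, ?_, ?_, ?_⟩
  · intro f hf
    rw [Set.Finite.mem_toFinset]
    exact hMsat ⟨f, Or.inl hf, Atom.map_eq_self fun i => hroot _ (hDb f hf i)⟩
  · rw [Set.Finite.coe_toFinset]
    intro r hr
    rcases hPE.symm ▸ hr with hrP | hrE
    · exact Rule.Holds.saturation hr (hPv r hrP) (hSr r hr).2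
    · intro σ hσ
      obtain ⟨n, hn⟩ : ∃ n, n = σ (s.front r) := ⟨_, rfl⟩
      -- A frontier variable in the body takes its value in the range of `ρ`, where `ρ` is the
      -- identity; otherwise `n` is arbitrary.
      have hσn : ∀ v ∈ vars r.body, v = s.front r → σ v = ρ n := by
        rintro v ⟨a, ha, i, rfl⟩ hv
        obtain ⟨m, hm⟩ := (hσ a ha).1.2 i
        have hm' : ρ m = σ (a.args i) := hm
        rw [hn, ← hv, ← hm', hidem]
      have hfire : s.Fires P E D r n := by
        have hX : ∀ f ∈ ({mark n} : Set Fact), ∀ i, f.args i = n := by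
          rintro _ rfl i
          rfl
        have hunion : s.Closed P E D (s.chase P E D ∪ {mark n}) := hchase.union (by
          rintro r' hr' _ rfl hmem
          rw [hPE] at hr'
          exact hp ((hSr r' hr').1 hmem))
        obtain ⟨τ, hτ⟩ := transfer n {mark n} hX (mark (s.front r) :: r.body) (hL.2 r hrE) (by
            rw [Set.image_union]
            exact hMfin.union ((Set.finite_singleton _).image _)) (by
            intro A hA hAT
            rw [Set.image_union, Set.union_subset_iff] at hA
            refine ⟨Function.update σ (s.front r) (ρ n), fun a ha => ?_⟩
            rcases List.mem_cons.1 ha with rfl | ha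
            · refine hA.2 ⟨mark n, rfl, ?_⟩
              simp only [mark, Atom.map, Function.comp_def, Function.update_self]
            · have h1 : Sat A σ r.body := hσ.mono (saturation_subset hA.1 hAT)
              refine (h1.congr fun v hv => ?_) a ha
              by_cases hvf : v = s.front r
              · rw [hσn v hv hvf, hvf, Function.update_self]
              · rw [Function.update_of_ne hvf])
          (Set.union_subset_union_left _ (s.skeleton_subset_chase P E D))
          (hPE ▸ hunion.models hs)
        refine ⟨τ, Sat.of_union (X := {mark n}) (fun a ha => hτ a (List.mem_cons_of_mem _ ha)) ?_,
          ?_⟩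
        · rintro _ rfl hmem
          exact hp ((hSr r hr).1 hmem)
        · rcases hτ _ List.mem_cons_self with h1 | h1
          · exfalso
            -- The chase uses only symbols in `S`, so the mark must be matched by the added fact,
            -- which gives `τ (s.front r) = n`.
            have hclosed : s.Closed P E D {f | f.sym ∈ S} := by
              refine ⟨fun f hf => hskelS f (Or.inl hf), fun r' hr' _ _ a ha => ?_,
                fun r' hr' _ _ a ha => ?_⟩
              · exact (hSr r' (hPE ▸ Or.inl hr')).2 ⟨a, ha, rfl⟩
              · exact (hSr r' (hET hr')).2 ⟨a, ha, rfl⟩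
            exact hp (h1 _ hclosed)
          · have h2 : Atom.map τ (mark (s.front r)) = mark n := h1
            simp only [mark, Atom.map, Atom.mk.injEq, heq_eq_eq, true_and] at h2
            exact congrFun h2 0
      -- Since `r` fires at `n`, the skeleton has the head facts at `n`; their `ρ`-images satisfy
      -- the head.
      refine ⟨fun v => if v ∈ vars r.body then σ v else ρ (s.witness r n v),
        fun v hv => if_pos hv, fun a ha => hMsat ⟨a.map (s.witness r n),
          Or.inr ⟨r, hrE, n, hfire, a, ha, rfl⟩, ?_⟩⟩
      rw [Atom.map_map]
      refine Atom.map_congr fun i => ?_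
      by_cases hv : a.args i ∈ vars r.body
      · have hvf : a.args i = s.front r := hs.inter r hrE ⟨hv, mem_vars ha i⟩
        rw [if_pos hv, hσn _ hv hvf]
        simp [Skolem.witness, hvf]
      · rw [if_neg hv]
        rfl
  · rw [Set.Finite.coe_toFinset]
    rintro ⟨σ, hσ⟩
    refine hnot fun A hDA hA => ?_
    obtain ⟨H, hH⟩ := Skolem.exists_hom_of_models hs hDb hPv hDA (hPE.symm ▸ hA)
    obtain ⟨τ, hτ⟩ := transfer 0 ∅ (fun _ h => h.elim) Φ hL.1
      (by rwa [Set.union_empty])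
      (fun A hMA hA => ⟨σ, hσ.mono (saturation_subset (by rwa [Set.union_empty] at hMA) hA)⟩)
      (by rw [Set.union_empty]; exact s.skeleton_subset_chase P E D)
      (hPE ▸ hchase.models hs)
    exact ⟨H ∘ τ, fun a ha => hH _ (hτ a ha)⟩
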